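/- For a set $X\subseteq\omega$ let $[X]^2$ be the set of two-element subsets of $X$; for $k\ge 1$ identify $k$ with $\{0,\dots,k-1\}$, and for a coloring $c:[\omega]^2\to k$ write $c(x,y)$ for $c(\{x,y\})$ when $x<y$. The coloring $c$ is \emph{stable} if for every $x$ there is $j<k$ with $\lim_y c(x,y)=j$, i.e. $c(x,y)=j$ for all sufficiently large $y$. A set $H\subseteq\omega$ is \emph{homogeneous} for $c$ if $c$ is constant on $[H]^2$. A set $L\subseteq\omega$ is \emph{limit-homogeneous} for a stable $c$ if there is $j<k$ with $\lim_y c(x,y)=j$ for all $x\in L$. For a Turing functional $\Psi$ and sets $L,H\subseteq\omega$, we say that $\Psi^L$ is equal to $H$ if $\Psi^L$ is total and is the characteristic function of $H$. Theorem. Let $\Psi$ be a Turing functional. There is a computable stable coloring $c:[\omega]^2\to 2$ such that for every $k\ge 2$, every stable coloring $d:[\omega]^2\to k$ (computable or not) has an infinite limit-homogeneous set $L$ such that $\Psi^L$ is not equal to any infinite homogeneous set for $c$. -/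

import Mathlib

/-- Programs for oracle computations: the clauses of `Nat.RecursiveIn`, with one call to the
oracle. Each program is (an index of) a Turing functional `X ↦ Ψ.eval X`. -/
inductive TuringFunctional : Type
  | zero : TuringFunctional
  | succ : TuringFunctional
  | left : TuringFunctional
  | right : TuringFunctional
  | oracle : TuringFunctional
  | pair : TuringFunctional → TuringFunctional → TuringFunctional
  | comp : TuringFunctional → TuringFunctional → TuringFunctional
  | prec : TuringFunctional → TuringFunctional → TuringFunctional
  | rfind : TuringFunctional → TuringFunctional

/-- The characteristic function of a set of natural numbers. -/
noncomputable def charFun (X : Set ℕ) : ℕ → ℕ := X.indicator fun _ => 1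

namespace TuringFunctional

/-- The partial function `Ψ^X` computed by the Turing functional `Ψ` with oracle `X`. -/
noncomputable def eval (X : Set ℕ) : TuringFunctional → ℕ →. ℕ
  | zero => fun _ => Part.some 0
  | succ => fun n => Part.some (n + 1)
  | left => fun n => Part.some n.unpair.1
  | right => fun n => Part.some n.unpair.2
  | oracle => fun n => Part.some (charFun X n)
  | pair f h => fun n => Nat.pair <$> eval X f n <*> eval X h n
  | comp f h => fun n => eval X h n >>= eval X f
  | prec f h => fun p =>
      let (a, n) := Nat.unpair p
      n.rec (eval X f a) fun y IH => do
        let i ← IH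
        eval X h (Nat.pair a (Nat.pair y i))
  | rfind f => fun a => Nat.rfind fun n => (fun m => m = 0) <$> eval X f (Nat.pair a n)

/-- The functions `Ψ^X`, for `Ψ` a Turing functional, are exactly the partial functions that are
recursive in the oracle `X`. -/
theorem exists_eval_eq_iff (X : Set ℕ) (f : ℕ →. ℕ) :
    (∃ Ψ : TuringFunctional, Ψ.eval X = f) ↔ Nat.RecursiveIn {(charFun X : ℕ →. ℕ)} f := by
  constructor
  · rintro ⟨Ψ, rfl⟩
    induction Ψ with
    | zero => exact .zero
    | succ => exact .succ
    | left => exact .left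
    | right => exact .right
    | oracle => exact .oracle _ rfl
    | pair f h ihf ihh => exact .pair ihf ihh
    | comp f h ihf ihh => exact .comp ihf ihh
    | prec f h ihf ihh => exact .prec ihf ihh
    | rfind f ihf => exact .rfind ihf
  · intro h
    induction h with
    | zero => exact ⟨zero, rfl⟩
    | succ => exact ⟨succ, rfl⟩
    | left => exact ⟨left, rfl⟩
    | right => exact ⟨right, rfl⟩
    | oracle g hg => exact ⟨oracle, hg.symm⟩
    | pair _ _ ihf ihh =>
      obtain ⟨F, rfl⟩ := ihf
      obtain ⟨H, rfl⟩ := ihh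
      exact ⟨pair F H, rfl⟩
    | comp _ _ ihf ihh =>
      obtain ⟨F, rfl⟩ := ihf
      obtain ⟨H, rfl⟩ := ihh
      exact ⟨comp F H, rfl⟩
    | prec _ _ ihf ihh =>
      obtain ⟨F, rfl⟩ := ihf
      obtain ⟨H, rfl⟩ := ihh
      exact ⟨prec F H, rfl⟩
    | rfind _ ihf =>
      obtain ⟨F, rfl⟩ := ihf
      exact ⟨rfind F, rfl⟩

/-- `Ψ^L` is the set `H`: it is total, and it is the characteristic function of `H`. -/
def EvalEqSet (Ψ : TuringFunctional) (L H : Set ℕ) : Prop :=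
  ∀ n, Ψ.eval L n = Part.some (charFun H n)

end TuringFunctional

/-- The set `[ω]²`; a two-element set is represented by its increasing enumeration `x < y`. -/
abbrev OmegaPairs : Type := {p : ℕ × ℕ // p.1 < p.2}

/-- The standard coding of `[ω]²`, as a primitive recursive set of pairs. -/
instance OmegaPairs.instPrimcodable : Primcodable OmegaPairs :=
  Primcodable.subtype Primrec.nat_lt

/-- Colorings `[ω]² → k`. -/
abbrev PairColoring (k : ℕ) : Type := OmegaPairs → Fin k

namespace PairColoring

variable {k : ℕ}

/-- `lim_y c(x, y) = j`. -/
def LimitEq (c : PairColoring k) (x : ℕ) (j : Fin k) : Prop :=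
  ∃ z : ℕ, ∀ y : ℕ, z ≤ y → ∀ h : x < y, c ⟨(x, y), h⟩ = j

/-- The limit `lim_y c(x, y)` exists for every `x`. -/
def Stable (c : PairColoring k) : Prop :=
  ∀ x : ℕ, ∃ j : Fin k, c.LimitEq x j

/-- `c` is constant on `[H]²`. -/
def Homogeneous (c : PairColoring k) (H : Set ℕ) : Prop :=
  ∃ j : Fin k, ∀ x ∈ H, ∀ y ∈ H, ∀ h : x < y, c ⟨(x, y), h⟩ = j

/-- All elements of `L` have the same limit color. -/
def LimitHomogeneous (c : PairColoring k) (L : Set ℕ) : Prop :=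
  ∃ j : Fin k, ∀ x ∈ L, c.LimitEq x j

end PairColoring

/-! Suppose first that every infinite `Y` has an infinite subset `L` for which `Ψ^L` is no infinite
set. Then a constant coloring works: apply this to an infinite limit-homogeneous `Y` for `d`; its
subsets remain limit-homogeneous.

Otherwise fix a `Y` with no such subset. It serves only to show that a search terminates. Cut `ω`
into consecutive finite blocks `[N, N')` such that, for every `N`-coloring of `[0, N')`, some finite
monochromatic oracle with elements at least `N` already makes `Ψ` output 1 at two points of the
block. Compactness and the use principle give `N'` (`exists_isBlock`); being a block is decidable,
so the blocks are computable. Let `c` be 0 within blocks and 1 across them: all limits are 1, and an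
infinite homogeneous set meets each block at most once.

Given `d`, view its limit colors as an `N`-coloring for a late block start `N`. The finite oracle
obtained there extends to an infinite set of the same limit color, and `Ψ` of it contains two points
of one block (`exists_infinite_monochromatic_of_isBlock`). -/

theorem charFun_eq_one {X : Set ℕ} {n : ℕ} : charFun X n = 1 ↔ n ∈ X := by
  by_cases h : n ∈ X <;> simp [charFun, h]

theorem charFun_lt_two (X : Set ℕ) (n : ℕ) : charFun X n < 2 := by
  by_cases h : n ∈ X <;> simp [charFun, h]

/-! ### Partial oracles: monotonicity, use, effectiveness -/

namespace TuringFunctional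

/-- The evaluation of a Turing functional with a partial function as its oracle. -/
def evalPartial (O : ℕ →. ℕ) : TuringFunctional → ℕ →. ℕ
  | zero => fun _ => Part.some 0
  | succ => fun n => Part.some (n + 1)
  | left => fun n => Part.some n.unpair.1
  | right => fun n => Part.some n.unpair.2
  | oracle => O
  | pair f h => fun n =>
      (evalPartial O f n).bind fun a => (evalPartial O h n).map fun b => Nat.pair a b
  | comp f h => fun n => (evalPartial O h n).bind (evalPartial O f)
  | prec f h => fun p =>
      p.unpair.2.rec (evalPartial O f p.unpair.1) fun y IH =>
        IH.bind fun i => evalPartial O h (Nat.pair p.unpair.1 (Nat.pair y i))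
  | rfind f => fun a =>
      Nat.rfind fun n => (evalPartial O f (Nat.pair a n)).map fun m => decide (m = 0)

theorem evalPartial_charFun (X : Set ℕ) (Ψ : TuringFunctional) :
    Ψ.evalPartial (charFun X : ℕ →. ℕ) = Ψ.eval X := by
  induction Ψ with
  | zero => rfl
  | succ => rfl
  | left => rfl
  | right => rfl
  | oracle => rfl
  | pair f h ihf ihh =>
    funext n
    simp [evalPartial, eval, ihf, ihh, Seq.seq, Part.bind_map]
  | comp f h ihf ihh => simp only [evalPartial, eval, ihf, ihh]; rfl
  | prec f h ihf ihh => funext n; simp [evalPartial, eval, ihf, ihh]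
  | rfind f ihf => funext n; simp [evalPartial, eval, ihf]

theorem mem_evalPartial_comp {O : ℕ →. ℕ} {f h : TuringFunctional} {n v : ℕ} :
    v ∈ (comp f h).evalPartial O n ↔ ∃ a ∈ h.evalPartial O n, v ∈ f.evalPartial O a :=
  Part.mem_bind_iff

theorem mem_evalPartial_rfind {O : ℕ →. ℕ} {f : TuringFunctional} {n v : ℕ} :
    v ∈ (rfind f).evalPartial O n ↔
      (∃ a ∈ f.evalPartial O (Nat.pair n v), decide (a = 0) = true) ∧
        ∀ {m : ℕ}, m < v → ∃ a ∈ f.evalPartial O (Nat.pair n m), decide (a = 0) = false := by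
  simp only [← Part.mem_map_iff]
  exact Nat.mem_rfind

theorem evalPartial_mono {O O' : ℕ →. ℕ} (hO : ∀ n v, v ∈ O n → v ∈ O' n) (Ψ : TuringFunctional) :
    ∀ n v, v ∈ Ψ.evalPartial O n → v ∈ Ψ.evalPartial O' n := by
  induction Ψ with
  | zero => exact fun _ _ h => h
  | succ => exact fun _ _ h => h
  | left => exact fun _ _ h => h
  | right => exact fun _ _ h => h
  | oracle => exact hO
  | pair f h ihf ihh =>
    intro n v hv
    simp only [evalPartial, Part.mem_bind_iff, Part.mem_map_iff] at hv ⊢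
    obtain ⟨a, ha, b, hb, rfl⟩ := hv
    exact ⟨a, ihf _ _ ha, b, ihh _ _ hb, rfl⟩
  | comp f h ihf ihh =>
    intro n v hv
    simp only [mem_evalPartial_comp] at hv ⊢
    obtain ⟨a, ha, hb⟩ := hv
    exact ⟨a, ihh _ _ ha, ihf _ _ hb⟩
  | prec f h ihf ihh =>
    intro n
    simp only [evalPartial]
    induction n.unpair.2 with
    | zero => exact ihf _
    | succ y ih =>
      intro v hv
      simp only [Part.mem_bind_iff] at hv ⊢
      obtain ⟨a, ha, hb⟩ := hv
      exact ⟨a, ih _ ha, ihh _ _ hb⟩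
  | rfind f ihf =>
    intro n v hv
    simp only [mem_evalPartial_rfind] at hv ⊢
    obtain ⟨⟨a, ha, h0⟩, hb⟩ := hv
    refine ⟨⟨a, ihf _ _ ha, h0⟩, fun {m} hm => ?_⟩
    obtain ⟨b, hb, h1⟩ := hb hm
    exact ⟨b, ihf _ _ hb, h1⟩

/-- The restriction of an oracle to the questions below `m`. -/
def restrictBelow (O : ℕ →. ℕ) (m : ℕ) : ℕ →. ℕ :=
  fun n => if n < m then O n else Part.none

theorem evalPartial_restrictBelow_mono {O : ℕ →. ℕ} {m m' : ℕ} (h : m ≤ m')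
    (Ψ : TuringFunctional) {n v : ℕ} (hv : v ∈ Ψ.evalPartial (restrictBelow O m) n) :
    v ∈ Ψ.evalPartial (restrictBelow O m') n := by
  refine evalPartial_mono (fun i w hw => ?_) Ψ n v hv
  unfold restrictBelow at hw ⊢
  split_ifs at hw with hi
  · rwa [if_pos (hi.trans_le h)]
  · exact absurd hw (Part.notMem_none _)

/-- The use principle. -/
theorem exists_mem_evalPartial_restrictBelow (O : ℕ →. ℕ) (Ψ : TuringFunctional) :
    ∀ n v, v ∈ Ψ.evalPartial O n → ∃ m, v ∈ Ψ.evalPartial (restrictBelow O m) n := by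
  induction Ψ with
  | zero => exact fun _ _ h => ⟨0, h⟩
  | succ => exact fun _ _ h => ⟨0, h⟩
  | left => exact fun _ _ h => ⟨0, h⟩
  | right => exact fun _ _ h => ⟨0, h⟩
  | oracle => exact fun n v h => ⟨n + 1, by simpa [evalPartial, restrictBelow] using h⟩
  | pair f h ihf ihh =>
    intro n v hv
    simp only [evalPartial, Part.mem_bind_iff, Part.mem_map_iff] at hv ⊢
    obtain ⟨a, ha, b, hb, rfl⟩ := hv
    obtain ⟨m₁, h₁⟩ := ihf _ _ ha
    obtain ⟨m₂, h₂⟩ := ihh _ _ hb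
    exact ⟨max m₁ m₂, a, evalPartial_restrictBelow_mono (le_max_left _ _) _ h₁, b,
      evalPartial_restrictBelow_mono (le_max_right _ _) _ h₂, rfl⟩
  | comp f h ihf ihh =>
    intro n v hv
    simp only [mem_evalPartial_comp] at hv ⊢
    obtain ⟨a, ha, hb⟩ := hv
    obtain ⟨m₁, h₁⟩ := ihh _ _ ha
    obtain ⟨m₂, h₂⟩ := ihf _ _ hb
    exact ⟨max m₁ m₂, a, evalPartial_restrictBelow_mono (le_max_left _ _) _ h₁,
      evalPartial_restrictBelow_mono (le_max_right _ _) _ h₂⟩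
  | prec f h ihf ihh =>
    intro n
    -- Monotonicity is recorded for the whole recursion before unfolding, since the induction needs
    -- it for the intermediate values.
    have hmono : ∀ (m m' v k : ℕ), m ≤ m' →
        v ∈ (prec f h).evalPartial (restrictBelow O m) (Nat.pair n.unpair.1 k) →
        v ∈ (prec f h).evalPartial (restrictBelow O m') (Nat.pair n.unpair.1 k) :=
      fun m m' v k hm => evalPartial_restrictBelow_mono hm _
    simp only [evalPartial, Nat.unpair_pair] at hmono ⊢
    induction n.unpair.2 with
    | zero => exact ihf _
    | succ y ih =>
      intro v hv
      simp only [Part.mem_bind_iff] at hv ⊢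
      obtain ⟨a, ha, hb⟩ := hv
      obtain ⟨m₁, h₁⟩ := ih _ ha
      obtain ⟨m₂, h₂⟩ := ihh _ _ hb
      exact ⟨max m₁ m₂, a, hmono _ _ _ _ (le_max_left _ _) h₁,
        evalPartial_restrictBelow_mono (le_max_right _ _) _ h₂⟩
  | rfind f ihf =>
    intro n v hv
    simp only [mem_evalPartial_rfind] at hv ⊢
    obtain ⟨⟨a, ha, h0⟩, hb⟩ := hv
    obtain ⟨m₁, h₁⟩ := ihf _ _ ha
    -- Only the finitely many tests below `v` are consulted, so their uses have a common bound.
    have key : ∀ k, ∃ M, k < v → ∃ b, b ∈ f.evalPartial (restrictBelow O M) (Nat.pair n k) ∧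
        decide (b = 0) = false := by
      intro k
      by_cases hk : k < v
      · obtain ⟨b, hb, h1⟩ := hb hk
        obtain ⟨M, hM⟩ := ihf _ _ hb
        exact ⟨M, fun _ => ⟨b, hM, h1⟩⟩
      · exact ⟨0, fun h => absurd h hk⟩
    choose M hM using key
    refine ⟨max m₁ ((Finset.range v).sup M),
      ⟨a, evalPartial_restrictBelow_mono (le_max_left _ _) _ h₁, h0⟩, fun {k} hk => ?_⟩
    obtain ⟨b, hb, h1⟩ := hM k hk
    exact ⟨b, evalPartial_restrictBelow_mono
      ((Finset.le_sup (f := M) (Finset.mem_range.2 hk)).trans (le_max_right _ _)) _ hb, h1⟩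

/-- Uniformity in the parameter `a` makes computations from coded finite oracles enumerable, as the
search for blocks requires. -/
theorem partrec_evalPartial {α : Type*} [Primcodable α] {O : α → ℕ →. ℕ} (hO : Partrec₂ O)
    (Ψ : TuringFunctional) : Partrec₂ fun a n => Ψ.evalPartial (O a) n := by
  induction Ψ with
  | zero => exact (Computable.const 0).partrec
  | succ => exact (Computable.succ.comp Computable.snd).partrec
  | left => exact (Computable.fst.comp (Computable.unpair.comp Computable.snd)).partrec
  | right => exact (Computable.snd.comp (Computable.unpair.comp Computable.snd)).partrec
  | oracle => exact hO
  | pair f h ihf ihh =>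
    refine Partrec.bind ihf (Partrec.map
      (ihh.comp (Computable.fst.comp Computable.fst) (Computable.snd.comp Computable.fst)) ?_)
    exact (Primrec₂.natPair.to_comp.comp (Computable.snd.comp Computable.fst) Computable.snd)
  | comp f h ihf ihh =>
    exact Partrec.bind ihh (ihf.comp (Computable.fst.comp Computable.fst) Computable.snd)
  | prec f h ihf ihh =>
    have h₁ : Computable fun p : α × ℕ => p.2.unpair.1 :=
      Computable.fst.comp (Computable.unpair.comp Computable.snd)
    have h₂ : Computable fun p : α × ℕ => p.2.unpair.2 :=
      Computable.snd.comp (Computable.unpair.comp Computable.snd)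
    refine Partrec.nat_rec (h := fun (p : α × ℕ) (q : ℕ × ℕ) =>
      h.evalPartial (O p.1) (Nat.pair p.2.unpair.1 (Nat.pair q.1 q.2))) h₂
      (ihf.comp Computable.fst h₁) ?_
    refine ihh.comp (Computable.fst.comp Computable.fst) ?_
    exact Primrec₂.natPair.to_comp.comp (h₁.comp Computable.fst)
      (Primrec₂.natPair.to_comp.comp (Computable.fst.comp Computable.snd)
        (Computable.snd.comp Computable.snd))
  | rfind f ihf =>
    refine Partrec.rfind (p := fun (p : α × ℕ) n =>
      (f.evalPartial (O p.1) (Nat.pair p.2 n)).map fun m => decide (m = 0)) ?_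
    refine Partrec.map (ihf.comp (Computable.fst.comp Computable.fst)
      (Primrec₂.natPair.to_comp.comp (Computable.snd.comp Computable.fst) Computable.snd)) ?_
    exact (Primrec.eq.comp Primrec.snd (Primrec.const 0)).decide.to_comp

end TuringFunctional

/-! ### Coding finite colorings and finite oracles by numbers -/

/-- The `i`-th digit of `e` in base `b`. -/
def natDigit (b e i : ℕ) : ℕ := e / b ^ i % b

theorem exists_natDigit_eq {b : ℕ} {u : ℕ → ℕ} (hu : ∀ i, u i < b) (m : ℕ) :
    ∃ e < b ^ m, ∀ i < m, natDigit b e i = u i := by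
  have hb : 0 < b := (Nat.zero_le _).trans_lt (hu 0)
  induction m with
  | zero => exact ⟨0, by simp, by simp⟩
  | succ m ih =>
    obtain ⟨e, he, h⟩ := ih
    refine ⟨e + b ^ m * u m, ?_, fun i hi => ?_⟩
    · calc e + b ^ m * u m < b ^ m * (u m + 1) := by rw [mul_add, mul_one, add_comm]; omega
        _ ≤ b ^ m * b := Nat.mul_le_mul_left _ (hu m)
        _ = b ^ (m + 1) := (pow_succ _ _).symm
    · unfold natDigit at h ⊢
      rcases Nat.lt_succ_iff_lt_or_eq.1 hi with hi | rfl
      · rw [← h i hi]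
        obtain ⟨r, rfl⟩ := Nat.exists_eq_add_of_lt hi
        have : b ^ (i + r + 1) * u (i + r + 1) = b ^ i * (b * (b ^ r * u (i + r + 1))) := by ring
        rw [this, Nat.add_mul_div_left _ _ (pow_pos hb i), Nat.add_mul_mod_self_left]
      · rw [Nat.add_mul_div_left _ _ (pow_pos hb i), Nat.div_eq_of_lt he, zero_add,
          Nat.mod_eq_of_lt (hu i)]

theorem primrec_natPow : Primrec₂ fun a b : ℕ => a ^ b :=
  Primrec₂.unpaired'.1 Nat.Primrec.pow

theorem primrec_natDigit {α : Type*} [Primcodable α] {b e i : α → ℕ} (hb : Primrec b)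
    (he : Primrec e) (hi : Primrec i) : Primrec fun a => natDigit (b a) (e a) (i a) :=
  Primrec.nat_mod.comp (Primrec.nat_div.comp he (primrec_natPow.comp hb hi)) hb

/-- The oracle that answers the questions below `s.1` by the binary digits of `s.2`. -/
def finiteOracle (s : ℕ × ℕ) : ℕ →. ℕ :=
  TuringFunctional.restrictBelow (natDigit 2 s.2 : ℕ → ℕ) s.1

theorem partrec_finiteOracle : Partrec₂ finiteOracle := by
  have : Primrec fun p : (ℕ × ℕ) × ℕ =>
      if p.2 < p.1.1 then some (natDigit 2 p.1.2 p.2) else none :=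
    Primrec.ite (Primrec.nat_lt.comp Primrec.snd (Primrec.fst.comp Primrec.fst))
      (Primrec.option_some.comp (primrec_natDigit (Primrec.const 2)
        (Primrec.snd.comp Primrec.fst) Primrec.snd)) (Primrec.const none)
  refine this.to_comp.ofOption.of_eq fun p => ?_
  unfold finiteOracle TuringFunctional.restrictBelow
  split_ifs <;> rfl

theorem finiteOracle_eq_restrictBelow {m f : ℕ} {X : Set ℕ}
    (h : ∀ i < m, natDigit 2 f i = charFun X i) :
    finiteOracle (m, f) = TuringFunctional.restrictBelow (charFun X : ℕ → ℕ) m := by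
  funext i
  unfold finiteOracle TuringFunctional.restrictBelow
  split_ifs with hi
  · simp [h i hi]
  · rfl

/-! ### Blocks: decidability and existence -/

/-- A partial recursive function takes a given value iff some stage of a primitive recursive
approximation confirms it. -/
theorem Partrec.exists_primrec_stages {α : Type*} [Primcodable α] {F : α →. ℕ} (hF : Partrec F)
    (v : ℕ) : ∃ H : ℕ → α → Prop, PrimrecRel H ∧ (∀ t t' a, t ≤ t' → H t a → H t' a) ∧
      ∀ a, v ∈ F a ↔ ∃ t, H t a := by
  obtain ⟨c, hc⟩ := Nat.Partrec.Code.exists_code.1 hF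
  refine ⟨fun t a => Nat.Partrec.Code.evaln t c (Encodable.encode a) = some v, ?_, ?_, ?_⟩
  · refine Primrec.eq.comp (Nat.Partrec.Code.primrec_evaln.comp
      (((Primrec.fst).pair (Primrec.const c)).pair (Primrec.encode.comp Primrec.snd)))
      (Primrec.const _)
  · exact fun t t' a h => Nat.Partrec.Code.evaln_mono h
  · intro a
    have := Nat.Partrec.Code.evaln_complete (c := c) (n := Encodable.encode a) (x := v)
    rw [hc] at this
    simpa using this

/-- Every `N`-coloring of `[0, N')` admits a finite oracle (with elements of one color, all of
them at least `N`) that is seen at stage `N'` to put two elements into the block `[N, N')`. -/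
def IsBlock (H : ℕ → (ℕ × ℕ) × ℕ → Prop) (N N' : ℕ) : Prop :=
  N < N' ∧ ∀ e < N ^ N', ∃ m < N', ∃ f < N', ∃ x < N', ∃ y < N',
    (N ≤ x ∧ x < y ∧ H N' ((m, f), x) ∧ H N' ((m, f), y)) ∧
    ∀ i < m, ∀ i' < m, natDigit 2 f i = 1 ∧ natDigit 2 f i' = 1 →
      N ≤ i ∧ natDigit N e i = natDigit N e i'

theorem PrimrecRel.bounded_exists {α : Type*} [Primcodable α] {R : α → ℕ → Prop}
    (hR : PrimrecRel R) {b : α → ℕ} (hb : Primrec b) : PrimrecPred fun a => ∃ x < b a, R a x :=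
  ((PrimrecRel.exists_mem_list hR.swap).comp (Primrec.list_range.comp hb) Primrec.id).of_eq
    fun a => by simp [Function.swap]

theorem PrimrecRel.bounded_forall {α : Type*} [Primcodable α] {R : α → ℕ → Prop}
    (hR : PrimrecRel R) {b : α → ℕ} (hb : Primrec b) : PrimrecPred fun a => ∀ x < b a, R a x :=
  ((PrimrecRel.forall_mem_list hR.swap).comp (Primrec.list_range.comp hb) Primrec.id).of_eq
    fun a => by simp [Function.swap]

theorem PrimrecPred.imp {α : Type*} [Primcodable α] {p q : α → Prop}
    (hp : PrimrecPred p) (hq : PrimrecPred q) : PrimrecPred fun a => p a → q a :=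
  (hp.not.or hq).of_eq fun _ => imp_iff_not_or.symm

theorem primrecRel_isBlock {H : ℕ → (ℕ × ℕ) × ℕ → Prop} (hH : PrimrecRel H) :
    PrimrecRel (IsBlock H) := by
  refine PrimrecPred.and (Primrec.nat_lt.comp Primrec.fst Primrec.snd) ?_
  refine PrimrecRel.bounded_forall ?_ (primrec_natPow.comp Primrec.fst Primrec.snd)
  have s1 : Primrec fun a : (ℕ × ℕ) × ℕ => a.1.2 := Primrec.snd.comp Primrec.fst
  refine PrimrecRel.bounded_exists ?_ s1
  have s2 : Primrec fun a : ((ℕ × ℕ) × ℕ) × ℕ => a.1.1.2 := s1.comp Primrec.fst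
  refine PrimrecRel.bounded_exists ?_ s2
  have s3 : Primrec fun a : (((ℕ × ℕ) × ℕ) × ℕ) × ℕ => a.1.1.1.2 := s2.comp Primrec.fst
  refine PrimrecRel.bounded_exists ?_ s3
  have s4 : Primrec fun a : ((((ℕ × ℕ) × ℕ) × ℕ) × ℕ) × ℕ => a.1.1.1.1.2 :=
    s3.comp Primrec.fst
  refine PrimrecRel.bounded_exists ?_ s4
  have s5 : Primrec fun a : (((((ℕ × ℕ) × ℕ) × ℕ) × ℕ) × ℕ) × ℕ => a.1.1.1.1.1.2 :=
    s4.comp Primrec.fst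
  have n5 : Primrec fun a : (((((ℕ × ℕ) × ℕ) × ℕ) × ℕ) × ℕ) × ℕ => a.1.1.1.1.1.1 :=
    Primrec.fst.comp (Primrec.fst.comp (Primrec.fst.comp (Primrec.fst.comp
      (Primrec.fst.comp Primrec.fst))))
  have e5 : Primrec fun a : (((((ℕ × ℕ) × ℕ) × ℕ) × ℕ) × ℕ) × ℕ => a.1.1.1.1.2 :=
    Primrec.snd.comp (Primrec.fst.comp (Primrec.fst.comp (Primrec.fst.comp Primrec.fst)))
  have m5 : Primrec fun a : (((((ℕ × ℕ) × ℕ) × ℕ) × ℕ) × ℕ) × ℕ => a.1.1.1.2 :=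
    Primrec.snd.comp (Primrec.fst.comp (Primrec.fst.comp Primrec.fst))
  have f5 : Primrec fun a : (((((ℕ × ℕ) × ℕ) × ℕ) × ℕ) × ℕ) × ℕ => a.1.1.2 :=
    Primrec.snd.comp (Primrec.fst.comp Primrec.fst)
  have x5 : Primrec fun a : (((((ℕ × ℕ) × ℕ) × ℕ) × ℕ) × ℕ) × ℕ => a.1.2 :=
    Primrec.snd.comp Primrec.fst
  refine PrimrecPred.and ((Primrec.nat_le.comp n5 x5).and ((Primrec.nat_lt.comp x5 Primrec.snd).and
    ((hH.comp s5 ((m5.pair f5).pair x5)).and (hH.comp s5 ((m5.pair f5).pair Primrec.snd))))) ?_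
  refine PrimrecRel.bounded_forall ?_ m5
  refine PrimrecRel.bounded_forall ?_ (m5.comp Primrec.fst)
  have i7 : Primrec fun a : ((((((((ℕ × ℕ) × ℕ) × ℕ) × ℕ) × ℕ) × ℕ) × ℕ) × ℕ) => a.1.2 :=
    Primrec.snd.comp Primrec.fst
  have p7 : Primrec fun a : ((((((((ℕ × ℕ) × ℕ) × ℕ) × ℕ) × ℕ) × ℕ) × ℕ) × ℕ) => a.1.1 :=
    Primrec.fst.comp Primrec.fst
  have f7 := f5.comp p7
  have n7 := n5.comp p7
  have e7 := e5.comp p7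
  refine PrimrecPred.imp (PrimrecPred.and ?_ ?_) (PrimrecPred.and ?_ ?_)
  · exact Primrec.eq.comp (primrec_natDigit (Primrec.const 2) f7 i7) (Primrec.const 1)
  · exact Primrec.eq.comp (primrec_natDigit (Primrec.const 2) f7 Primrec.snd) (Primrec.const 1)
  · exact Primrec.nat_le.comp n7 i7
  · exact Primrec.eq.comp (primrec_natDigit n7 e7 i7) (primrec_natDigit n7 e7 Primrec.snd)

/-- Compactness: if every `N'` fails, the bad colorings converge along an ultrafilter to an
`N`-coloring `X` of `ω`. Some color class of `X` in `Y` beyond `N` is an infinite `L`, so `Ψ^L` has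
two elements above `N`. Finitely much of `L` witnesses this, and a large bad coloring agreeing with
`X` there is refuted. -/
theorem exists_isBlock {Ψ : TuringFunctional} {H : ℕ → (ℕ × ℕ) × ℕ → Prop}
    (hmono : ∀ t t' a, t ≤ t' → H t a → H t' a)
    (hH : ∀ a : (ℕ × ℕ) × ℕ, 1 ∈ Ψ.evalPartial (finiteOracle a.1) a.2 ↔ ∃ t, H t a)
    {Y : Set ℕ} (hYinf : Y.Infinite)
    (hY : ∀ L ⊆ Y, L.Infinite → ∃ K : Set ℕ, K.Infinite ∧ Ψ.EvalEqSet L K) (N : ℕ) :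
    ∃ N', IsBlock H N N' := by
  rcases N.eq_zero_or_pos with rfl | hN
  -- There are no 0-colorings of a nonempty set: `0 ^ 1 = 0`.
  · exact ⟨1, by simp [IsBlock]⟩
  by_contra hno
  have hbad : ∀ N', ∃ e, N < N' → ¬ ∃ m < N', ∃ f < N', ∃ x < N', ∃ y < N',
      (N ≤ x ∧ x < y ∧ H N' ((m, f), x) ∧ H N' ((m, f), y)) ∧
      ∀ i < m, ∀ i' < m, natDigit 2 f i = 1 ∧ natDigit 2 f i' = 1 →
        N ≤ i ∧ natDigit N e i = natDigit N e i' := by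
    intro N'
    by_contra hcon
    refine hno ⟨N', ?_⟩
    have h := not_exists.1 hcon
    exact ⟨(Classical.not_imp.1 (h 0)).1, fun e _ => not_not.1 (Classical.not_imp.1 (h e)).2⟩
  choose e he using hbad
  have hlim : ∀ i, ∃ j < N, ∀ᶠ N' in (Filter.hyperfilter ℕ : Filter ℕ), natDigit N (e N') i = j := by
    intro i
    have h : (⋃ j ∈ Set.Iio N, {N' | natDigit N (e N') i = j}) ∈ Filter.hyperfilter ℕ := by
      refine Filter.mem_of_superset Filter.univ_mem fun N' _ => ?_
      simpa [natDigit] using Nat.mod_lt _ hN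
    obtain ⟨j, hj, h⟩ := (Ultrafilter.finite_biUnion_mem_iff (Set.finite_Iio N)).1 h
    exact ⟨j, hj, h⟩
  choose X hXlt hX using hlim
  obtain ⟨j, hj⟩ : ∃ j, {i | i ∈ Y ∧ N ≤ i ∧ X i = j}.Infinite := by
    by_contra hfin
    have hfin' : ∀ j, {i | i ∈ Y ∧ N ≤ i ∧ X i = j}.Finite :=
      fun j => Set.not_infinite.1 fun h => hfin ⟨j, h⟩
    refine hYinf (((Set.finite_Iio N).union ((Set.finite_Iio N).biUnion
      fun j _ => hfin' j)).subset fun i hi => ?_)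
    rcases lt_or_ge i N with h | h
    · exact Or.inl h
    · exact Or.inr (Set.mem_biUnion (Set.mem_Iio.2 (hXlt i)) ⟨hi, h, rfl⟩)
  set L := {i | i ∈ Y ∧ N ≤ i ∧ X i = j} with hL
  obtain ⟨K, hKinf, hK⟩ := hY L (fun i hi => hi.1) hj
  obtain ⟨x, hxK, hx⟩ := hKinf.exists_gt N
  obtain ⟨y, hyK, hxy⟩ := hKinf.exists_gt x
  have huse : ∀ z ∈ K, ∃ m, 1 ∈ Ψ.evalPartial
      (TuringFunctional.restrictBelow (charFun L : ℕ → ℕ) m) z := by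
    intro z hz
    refine TuringFunctional.exists_mem_evalPartial_restrictBelow _ Ψ z 1 ?_
    rw [TuringFunctional.evalPartial_charFun, hK z, charFun_eq_one.2 hz]
    exact Part.mem_some 1
  obtain ⟨m₁, h₁⟩ := huse x hxK
  obtain ⟨m₂, h₂⟩ := huse y hyK
  obtain ⟨f, -, hf⟩ := exists_natDigit_eq (charFun_lt_two L) (max m₁ m₂)
  set m := max m₁ m₂ with hm
  have hO := finiteOracle_eq_restrictBelow hf
  obtain ⟨t₁, ht₁⟩ := (hH ((m, f), x)).1 (by
    rw [hO]; exact TuringFunctional.evalPartial_restrictBelow_mono (le_max_left _ _) _ h₁)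
  obtain ⟨t₂, ht₂⟩ := (hH ((m, f), y)).1 (by
    rw [hO]; exact TuringFunctional.evalPartial_restrictBelow_mono (le_max_right _ _) _ h₂)
  have hagree : ∀ᶠ N' in (Filter.hyperfilter ℕ : Filter ℕ),
      ∀ i ∈ Set.Iio m, natDigit N (e N') i = X i :=
    (Filter.eventually_all_finite (Set.finite_Iio m)).2 fun i _ => hX i
  have hlarge : ∀ᶠ N' in (Filter.hyperfilter ℕ : Filter ℕ), N + m + f + x + y + t₁ + t₂ < N' :=
    Nat.hyperfilter_le_atTop (Filter.eventually_gt_atTop _)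
  obtain ⟨N', hag, hlg⟩ := (hagree.and hlarge).exists
  refine he N' (by omega) ⟨m, by omega, f, by omega, x, by omega, y, by omega,
    ⟨hx.le, hxy, hmono _ _ _ (by omega) ht₁, hmono _ _ _ (by omega) ht₂⟩, ?_⟩
  rintro i hi i' hi' ⟨h, h'⟩
  rw [hf i hi, charFun_eq_one] at h
  rw [hf i' hi', charFun_eq_one] at h'
  exact ⟨h.2.1, by rw [hag i hi, hag i' hi', h.2.2, h'.2.2]⟩

theorem PrimrecRel.exists_computable_choice {R : ℕ → ℕ → Prop} (hR : PrimrecRel R)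
    (h : ∀ n, ∃ k, R n k) : ∃ g : ℕ → ℕ, Computable g ∧ ∀ n, R n (g n) := by
  classical
  refine ⟨fun n => Nat.find (h n), ?_, fun n => Nat.find_spec (h n)⟩
  refine Partrec.of_eq_tot (f := fun n => Nat.rfind fun k => Part.some (decide (R n k)))
    (Partrec.rfind hR.decide.to_comp.partrec₂) fun n => ?_
  refine Nat.mem_rfind.2 ⟨?_, fun hm => ?_⟩
  · simpa using Nat.find_spec (h n)
  · simpa using Nat.find_min (h n) hm

/-! ### The block coloring -/

/-- The end of the block of `x`, where the block that starts at `n` ends at `g n`. -/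
def blockEnd (g : ℕ → ℕ) : ℕ → ℕ
  | 0 => g 0
  | x + 1 => if x + 1 < blockEnd g x then blockEnd g x else g (x + 1)

theorem computable_blockEnd {g : ℕ → ℕ} (hg : Computable g) : Computable (blockEnd g) := by
  have : Computable₂ fun (_ : ℕ) (q : ℕ × ℕ) =>
      cond (decide (q.1 + 1 < q.2)) q.2 (g (q.1 + 1)) := by
    have h₁ : Computable fun p : ℕ × (ℕ × ℕ) => p.2.1 + 1 :=
      Computable.succ.comp (Computable.fst.comp Computable.snd)
    have h₂ : Computable fun p : ℕ × (ℕ × ℕ) => p.2.2 := Computable.snd.comp Computable.snd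
    exact Computable.cond (Primrec.nat_lt.decide.to_comp.comp h₁ h₂) h₂ (hg.comp h₁)
  refine (Computable.nat_rec Computable.id (Computable.const (g 0)) this).of_eq fun x => ?_
  induction x with
  | zero => rfl
  | succ x ih =>
    simp only [id_eq] at ih ⊢
    rw [ih, Bool.cond_decide, blockEnd]

theorem lt_blockEnd {g : ℕ → ℕ} (hg : ∀ n, n < g n) (x : ℕ) : x < blockEnd g x := by
  induction x with
  | zero => exact hg 0
  | succ x ih =>
    rw [blockEnd]
    split_ifs with h
    exacts [h, hg _]

theorem blockEnd_eq_of_mem {g : ℕ → ℕ} {n : ℕ} {x : ℕ} (hnx : n ≤ x) (hx : x < blockEnd g n) :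
    blockEnd g x = blockEnd g n := by
  induction x, hnx using Nat.le_induction with
  | base => rfl
  | succ x _ ih => rw [blockEnd, ih (by omega), if_pos hx]

theorem blockEnd_blockEnd {g : ℕ → ℕ} (hg : ∀ n, n < g n) (n : ℕ) :
    blockEnd g (blockEnd g n) = g (blockEnd g n) := by
  have h := lt_blockEnd hg n
  obtain ⟨x, hx⟩ : ∃ x, blockEnd g n = x + 1 := ⟨blockEnd g n - 1, by omega⟩
  have hxe := blockEnd_eq_of_mem (g := g) (n := n) (x := x) (by omega) (by omega)
  -- The predecessor of `blockEnd g n` still lies in the block of `n`, so the recursion starts a new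
  -- block here.
  rw [hx, blockEnd, hxe, hx, if_neg (lt_irrefl _)]

/-- Pairs within a block get color `0`, and pairs from different blocks get color `1`. -/
def blockColoring (g : ℕ → ℕ) : PairColoring 2 :=
  fun p => if blockEnd g p.1.1 ≤ p.1.2 then 1 else 0

theorem computable_blockColoring {g : ℕ → ℕ} (hg : Computable g) :
    Computable (blockColoring g) := by
  have hv : Computable fun p : OmegaPairs => p.1 := Primrec.subtype_val.to_comp
  refine (Computable.cond (c := fun p : OmegaPairs => decide (blockEnd g p.1.1 ≤ p.1.2))
    (Primrec.nat_le.decide.to_comp.comp ((computable_blockEnd hg).comp (Computable.fst.comp hv))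
      (Computable.snd.comp hv)) (Computable.const (1 : Fin 2)) (Computable.const 0)).of_eq
    fun p => ?_
  simp only [blockColoring, Bool.cond_decide]

theorem blockColoring_limitEq (g : ℕ → ℕ) (x : ℕ) : (blockColoring g).LimitEq x 1 :=
  ⟨blockEnd g x, fun _ hy _ => if_pos hy⟩

/-- Two elements of one block give color 0, while the smaller one and any element of `H` past the
block give color 1. -/
theorem not_homogeneous_blockColoring {g : ℕ → ℕ} {H : Set ℕ} (hH : H.Infinite) {x y : ℕ}
    (hx : x ∈ H) (hy : y ∈ H) (hxy : x < y) (hyx : y < blockEnd g x) :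
    ¬ (blockColoring g).Homogeneous H := by
  rintro ⟨j, hj⟩
  obtain ⟨z, hz, hyz⟩ := hH.exists_gt (max y (blockEnd g x))
  have hxz : x < z := hxy.trans ((le_max_left _ _).trans_lt hyz)
  have h₀ := hj x hx y hy hxy
  have h₁ := hj x hx z hz hxz
  rw [blockColoring, if_neg (not_le.2 hyx)] at h₀
  rw [blockColoring, if_pos ((le_max_right _ _).trans hyz.le)] at h₁
  exact absurd (h₀.trans h₁.symm) (by decide)

/-! ### Defeating `Ψ` on limit-homogeneous sets -/

theorem PairColoring.Stable.exists_infinite_limitHomogeneous {k : ℕ} {d : PairColoring k}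
    (hd : d.Stable) : ∃ L : Set ℕ, L.Infinite ∧ d.LimitHomogeneous L := by
  choose A hA using hd
  obtain ⟨j, hj⟩ := Finite.exists_infinite_fiber A
  exact ⟨A ⁻¹' {j}, Set.infinite_coe_iff.1 hj, j, fun x hx => hx ▸ hA x⟩

/-- Every finite coloring of `ω` has an infinite monochromatic set `L` such that `Ψ^L` has
two elements in one of the blocks. -/
theorem exists_infinite_monochromatic_of_isBlock {Ψ : TuringFunctional}
    {H : ℕ → (ℕ × ℕ) × ℕ → Prop}
    (hH : ∀ a : (ℕ × ℕ) × ℕ, 1 ∈ Ψ.evalPartial (finiteOracle a.1) a.2 ↔ ∃ t, H t a)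
    {g : ℕ → ℕ} (hg : ∀ n, IsBlock H n (g n)) {k : ℕ} (A : ℕ → Fin k) :
    ∃ L : Set ℕ, L.Infinite ∧ (∃ j, ∀ i ∈ L, A i = j) ∧
      ∃ x y, x < y ∧ y < blockEnd g x ∧ 1 ∈ Ψ.eval L x ∧ 1 ∈ Ψ.eval L y := by
  have hlt : ∀ n, n < g n := fun n => (hg n).1
  -- From `n` on, only colors used infinitely often occur, so a finite oracle beyond `n` can be
  -- extended in its color.
  obtain ⟨n, hn⟩ : ∃ n, ∀ i, n ≤ i → {i' | A i' = A i}.Infinite := by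
    have hfin : (⋃ j ∈ {j | {i' | A i' = j}.Finite}, {i' | A i' = j}).Finite :=
      (Set.toFinite _).biUnion fun j hj => hj
    obtain ⟨b, hb⟩ := hfin.bddAbove
    refine ⟨b + 1, fun i hi hcon => ?_⟩
    have : i ≤ b := hb (Set.mem_biUnion (show A i ∈ {j | {i' | A i' = j}.Finite} from hcon) rfl)
    omega
  -- A block start past both `n` and `k`: `A` is then an `N`-coloring, and the oracle has no element
  -- below `n`.
  set N := blockEnd g (n + k) with hNdef
  have hN : n + k < N := lt_blockEnd hlt _
  have hend : blockEnd g N = g N := blockEnd_blockEnd hlt _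
  obtain ⟨e, he, hdig⟩ := exists_natDigit_eq (b := N) (u := fun i => (A i : ℕ))
    (fun i => by have := (A i).2; omega) (g N)
  obtain ⟨m, hm, f, -, x, hx, y, hy, ⟨hNx, hxy, hHx, hHy⟩, hmono⟩ := (hg N).2 e he
  obtain ⟨j, hjinf, hj⟩ : ∃ j, {i | A i = j}.Infinite ∧
      ∀ i < m, natDigit 2 f i = 1 → A i = j := by
    by_cases hne : ∃ i < m, natDigit 2 f i = 1
    · obtain ⟨i₀, hi₀, hf₀⟩ := hne
      refine ⟨A i₀, hn i₀ ?_, fun i hi hf => ?_⟩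
      · have := (hmono i₀ hi₀ i₀ hi₀ ⟨hf₀, hf₀⟩).1
        omega
      · have := (hmono i hi i₀ hi₀ ⟨hf, hf₀⟩).2
        rw [hdig i (hi.trans hm), hdig i₀ (hi₀.trans hm)] at this
        exact Fin.ext this
    -- An empty finite oracle may be extended in any color used infinitely often.
    · exact ⟨A n, hn n le_rfl, fun i hi hf => absurd ⟨i, hi, hf⟩ hne⟩
  -- Adding elements only from `m` on leaves every answer of the finite oracle unchanged.
  set L := {i | (i < m ∧ natDigit 2 f i = 1) ∨ (m ≤ i ∧ A i = j)} with hL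
  have hchar : ∀ i < m, natDigit 2 f i = charFun L i := by
    intro i hi
    by_cases h : natDigit 2 f i = 1
    · rw [h, charFun_eq_one.2 (Or.inl ⟨hi, h⟩)]
    · have hiL : i ∉ L := by
        rintro (h' | h')
        exacts [h h'.2, absurd h'.1 (by omega)]
      have h2 : natDigit 2 f i < 2 := Nat.mod_lt _ two_pos
      rw [charFun, Set.indicator_of_notMem hiL]
      omega
  have heval : ∀ z, H (g N) ((m, f), z) → 1 ∈ Ψ.eval L z := by
    intro z hz
    have h := (hH ((m, f), z)).2 ⟨_, hz⟩
    rw [finiteOracle_eq_restrictBelow hchar] at h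
    rw [← TuringFunctional.evalPartial_charFun]
    refine TuringFunctional.evalPartial_mono (fun i w hw => ?_) Ψ z 1 h
    unfold TuringFunctional.restrictBelow at hw
    split_ifs at hw
    exacts [hw, absurd hw (Part.notMem_none _)]
  refine ⟨L, ?_, ⟨j, ?_⟩, x, y, hxy, ?_, heval x hHx, heval y hHy⟩
  · refine (hjinf.sdiff (Set.finite_Iio m)).mono fun i hi => Or.inr ⟨not_lt.1 hi.2, hi.1⟩
  · rintro i (hi | hi)
    exacts [hj i hi.1 hi.2, hi.2]
  · rwa [blockEnd_eq_of_mem hNx (by rwa [hend]), hend]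

theorem mainTheorem7 (Ψ : TuringFunctional) :
    ∃ c : PairColoring 2, Computable c ∧ c.Stable ∧
      ∀ k : ℕ, 2 ≤ k → ∀ d : PairColoring k, d.Stable →
        ∃ L : Set ℕ, L.Infinite ∧ d.LimitHomogeneous L ∧
          ¬ ∃ H : Set ℕ, H.Infinite ∧ c.Homogeneous H ∧ Ψ.EvalEqSet L H := by
  by_cases hcase : ∃ Y : Set ℕ, Y.Infinite ∧
      ∀ L ⊆ Y, L.Infinite → ∃ K : Set ℕ, K.Infinite ∧ Ψ.EvalEqSet L K
  · obtain ⟨Y, hYinf, hY⟩ := hcase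
    obtain ⟨H, hHprim, hHmono, hH⟩ := Partrec.exists_primrec_stages
      (TuringFunctional.partrec_evalPartial partrec_finiteOracle Ψ) 1
    obtain ⟨g, hgcomp, hg⟩ := (primrecRel_isBlock hHprim).exists_computable_choice
      (exists_isBlock hHmono hH hYinf hY)
    refine ⟨blockColoring g, computable_blockColoring hgcomp,
      fun x => ⟨1, blockColoring_limitEq g x⟩, fun k _ d hd => ?_⟩
    choose A hA using hd
    obtain ⟨L, hLinf, ⟨j, hj⟩, x, y, hxy, hyx, hx, hy⟩ :=
      exists_infinite_monochromatic_of_isBlock hH hg A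
    refine ⟨L, hLinf, ⟨j, fun i hi => hj i hi ▸ hA i⟩, ?_⟩
    rintro ⟨K, hKinf, hhom, hK⟩
    have hmem : ∀ z, 1 ∈ Ψ.eval L z → z ∈ K := by
      intro z hz
      rw [hK z, Part.mem_some_iff] at hz
      exact charFun_eq_one.1 hz.symm
    exact not_homogeneous_blockColoring hKinf (hmem x hx) (hmem y hy) hxy hyx hhom
  · refine ⟨fun _ => 0, Computable.const 0, fun x => ⟨0, 0, fun _ _ _ => rfl⟩, fun k _ d hd => ?_⟩
    obtain ⟨Y, hYinf, j, hj⟩ := hd.exists_infinite_limitHomogeneous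
    by_contra hcon
    refine hcase ⟨Y, hYinf, fun L hLY hLinf => ?_⟩
    by_contra hno
    refine hcon ⟨L, hLinf, ⟨j, fun x hx => hj x (hLY hx)⟩, ?_⟩
    rintro ⟨K, hKinf, -, hK⟩
    exact hno ⟨K, hKinf, hK⟩
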